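/- Consider quantum circuits with all-to-all connectivity built from CNOT gates (between any two distinct qubits), Hadamard gates $H$, gates $T=\mathrm{diag}(1,e^{i\pi/4})$ and $T^\dagger$ (both counted as $T$ gates), and rotations $R_z(\theta)=\mathrm{diag}(e^{-i\theta/2},e^{i\theta/2})$ with arbitrary real angle $\theta$. For $W\in SU(2)$, a set $C$ of $n$ control qubits and a target qubit $q_t\notin C$ of a register of $k$ qubits, the multi-controlled gate $[W]^{C}_{q_t}$ applies $W$ to $q_t$ if all the qubits of $C$ are in state $|1\rangle$, and the identity otherwise. There is an absolute constant $c$, independent of $n$, $k$, $C$, $q_t$, $W$ and (in part 2) $q_a$, such that the following holds. 1. (No ancilla.) For every $k$, $C$, $q_t$ and every $W\in SU(2)$, the gate $[W]^{C}_{q_t}$ is exactly equal to a circuit that acts only on the $n+1$ qubits of $C\cup\{q_t\}$ and uses at most $6$ arbitrary $R_z$ gates, at most $12n+c$ CNOT gates, at most $16n+c$ $T$ gates and at most $8n+c$ $H$ gates. 2. (One dirty ancilla.) For every $k$, $C$, $q_t$, every further qubit $q_a\notin C\cup\{q_t\}$ and every $W\in SU(2)$, there is a circuit that acts only on $C\cup\{q_t,q_a\}$,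 is exactly equal to $[W]^{C}_{q_t}$ (so that $q_a$, in whatever state it starts, is returned unchanged), and uses at most $5$ arbitrary $R_z$ gates, at most $12n+c$ CNOT gates, at most $16n+c$ $T$ gates and at most $8n+c$ $H$ gates. -/

import Mathlib

noncomputable section

namespace MCSU2

/-- Operators on a register of `k` qubits, written in the computational basis, whose vectors
are labelled by the bit strings `Fin k → Fin 2`. -/
abbrev Operator (k : ℕ) : Type := Matrix (Fin k → Fin 2) (Fin k → Fin 2) ℂ

/-- The multi-controlled gate with control set `C`, target `t` (not in `C`) and single-qubit
operator `U`: apply `U` to qubit `t` if all the qubits of `C` are in state `1`, and the identity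
otherwise. The entry at `(x, y)` is `⟨x| · |y⟩`. All qubits other than `t` keep their basis
state. For `C = ∅` this is the single-qubit gate `U` on qubit `t`. -/
def controlledGate {k : ℕ} (C : Finset (Fin k)) (t : Fin k)
    (U : Matrix (Fin 2) (Fin 2) ℂ) : Operator k :=
  Matrix.of fun x y =>
    if ∀ j, j ≠ t → x j = y j then
      (if ∀ j ∈ C, y j = 1 then U (x t) (y t)
        else (1 : Matrix (Fin 2) (Fin 2) ℂ) (x t) (y t))
    else 0

/-- The Pauli `X` matrix. -/
def matX : Matrix (Fin 2) (Fin 2) ℂ := !![0, 1; 1, 0]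

/-- The Hadamard matrix. -/
def matH : Matrix (Fin 2) (Fin 2) ℂ := ((1 / Real.sqrt 2 : ℝ) : ℂ) • !![1, 1; 1, -1]

/-- The `T` matrix. -/
def matT : Matrix (Fin 2) (Fin 2) ℂ := !![1, 0; 0, Complex.exp (Complex.I * (Real.pi / 4))]

/-- The inverse of the `T` matrix. -/
def matTdg : Matrix (Fin 2) (Fin 2) ℂ := !![1, 0; 0, Complex.exp (-(Complex.I * (Real.pi / 4)))]

/-- The rotation about the `z` axis by the angle `θ`. -/
def matRz (θ : ℝ) : Matrix (Fin 2) (Fin 2) ℂ :=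
  !![Complex.exp (-(Complex.I * (θ / 2))), 0; 0, Complex.exp (Complex.I * (θ / 2))]

/-- The elementary gates on `k` qubits with all-to-all connectivity: a CNOT between any two
different qubits, `T` and its inverse, the Hadamard gate, and `R_z` with any real angle. -/
inductive Gate (k : ℕ) : Type
  | cnot (c t : Fin k) (hct : c ≠ t) : Gate k
  | T (t : Fin k) : Gate k
  | Tdg (t : Fin k) : Gate k
  | H (t : Fin k) : Gate k
  | Rz (θ : ℝ) (t : Fin k) : Gate k

/-- The operator that an elementary gate applies to the whole register. -/
def Gate.toOperator {k : ℕ} : Gate k → Operator k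
  | .cnot c t _ => controlledGate {c} t matX
  | .T t => controlledGate ∅ t matT
  | .Tdg t => controlledGate ∅ t matTdg
  | .H t => controlledGate ∅ t matH
  | .Rz θ t => controlledGate ∅ t (matRz θ)

/-- The qubits that an elementary gate touches. -/
def Gate.support {k : ℕ} : Gate k → Finset (Fin k)
  | .cnot c t _ => {c, t}
  | .T t => {t}
  | .Tdg t => {t}
  | .H t => {t}
  | .Rz _ t => {t}

def Gate.isCnot {k : ℕ} : Gate k → Bool
  | .cnot _ _ _ => true
  | _ => false

/-- Both `T` and its inverse are counted as `T` gates. -/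
def Gate.isT {k : ℕ} : Gate k → Bool
  | .T _ => true
  | .Tdg _ => true
  | _ => false

def Gate.isH {k : ℕ} : Gate k → Bool
  | .H _ => true
  | _ => false

def Gate.isRz {k : ℕ} : Gate k → Bool
  | .Rz _ _ => true
  | _ => false

/-- A circuit is a list of elementary gates; the head of the list is applied first. -/
abbrev Circuit (k : ℕ) : Type := List (Gate k)

/-- The operator that a circuit applies to the whole register. -/
def Circuit.toOperator {k : ℕ} : Circuit k → Operator k
  | [] => 1
  | g :: D => Circuit.toOperator D * g.toOperator

/-- The circuit touches no qubit outside `S`. -/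
def Circuit.UsesOnly {k : ℕ} (D : Circuit k) (S : Finset (Fin k)) : Prop :=
  ∀ g ∈ D, g.support ⊆ S

def Circuit.cnotCount {k : ℕ} (D : Circuit k) : ℕ := List.countP Gate.isCnot D

def Circuit.tCount {k : ℕ} (D : Circuit k) : ℕ := List.countP Gate.isT D

def Circuit.hCount {k : ℕ} (D : Circuit k) : ℕ := List.countP Gate.isH D

def Circuit.rzCount {k : ℕ} (D : Circuit k) : ℕ := List.countP Gate.isRz D

/-- The multi-controlled gate `W` with control set `C` and target `t` is implemented exactly,
without any further phase, by a circuit that touches only qubits of `S` and has at most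
`nCX` CNOT, `nT` `T`, `nH` Hadamard and `nRz` arbitrary `R_z` gates. -/
def ImplementableWith {k : ℕ} (S C : Finset (Fin k)) (t : Fin k)
    (W : Matrix (Fin 2) (Fin 2) ℂ) (nCX nT nH nRz : ℕ) : Prop :=
  ∃ D : Circuit k,
    Circuit.UsesOnly D S ∧
    Circuit.toOperator D = controlledGate C t W ∧
    Circuit.cnotCount D ≤ nCX ∧
    Circuit.tCount D ≤ nT ∧
    Circuit.hCount D ≤ nH ∧
    Circuit.rzCount D ≤ nRz

end MCSU2

end

noncomputable section

namespace MCSU2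

open Function

variable {k : ℕ}

/-! Write W = Rz(p) Ry(q) Rz(r) and single out one control u. Five rotations of the target, with
axis chosen by u, surround two copies of a controlled X. If u = 0 every axis is x: the rotations
commute with X, the two X gates cancel and the angles sum to zero. If u = 1 the axes are z and y,
whose rotations X inverts; the angles cancel without the X gates and compose to W with them
(`rotation_product`).

Hence the X gate only has to be controlled correctly when u = 1, and phases depending on the
controls are harmless because one copy is the inverse of the other. This freedom makes it cheap:
since u is known to be 1, it serves as work space, and a ladder of relative-phase Toffoli gates
overwrites the controls themselves, one gate per control (`exists_ladder`). Conjugating one Toffoli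
gate on the target by the ladder gives the X gate (`exists_conditional_controlled_X`). There are two
X gates, each with two ladders, at 3 CNOT, 4 T and 2 H per ladder gate, whence the slopes 12, 16 and
8.

No ancilla enters and five `Rz` gates suffice, so one circuit serves both parts. -/

/-! ### Operators on one qubit steered by the rest of the register -/

/-- The operator that applies to qubit `t` a single-qubit operator which depends on the basis
state of the register. -/
def blockGate (t : Fin k) (M : (Fin k → Fin 2) → Matrix (Fin 2) (Fin 2) ℂ) : Operator k :=
  Matrix.of fun x y => if ∀ j, j ≠ t → x j = y j then M y (x t) (y t) else 0

/-- The function does not depend on the bit `t`. -/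
def IndepOf {α : Type*} (t : Fin k) (M : (Fin k → Fin 2) → α) : Prop :=
  ∀ y b, M (update y t b) = M y

theorem controlledGate_eq_blockGate (C : Finset (Fin k)) (t : Fin k)
    (U : Matrix (Fin 2) (Fin 2) ℂ) :
    controlledGate C t U = blockGate t fun y => if ∀ j ∈ C, y j = 1 then U else 1 := by
  ext x y
  simp only [controlledGate, blockGate, Matrix.of_apply]
  split_ifs <;> rfl

theorem eq_update_of_agree {t : Fin k} {x y : Fin k → Fin 2} (h : ∀ j, j ≠ t → x j = y j) :
    x = update y t (x t) := by
  funext j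
  by_cases hj : j = t
  · subst hj; simp
  · simp [hj, h j hj]

theorem mul_blockGate_apply (A : Operator k) (b : Fin k)
    (M : (Fin k → Fin 2) → Matrix (Fin 2) (Fin 2) ℂ) (x y : Fin k → Fin 2) :
    (A * blockGate b M) x y = ∑ i, A x (update y b i) * M y i (y b) := by
  rw [Matrix.mul_apply]
  symm
  refine Finset.sum_of_injOn (fun i => update y b i) ?_ (by simp) ?_ ?_
  · intro i _ j _ h
    simpa using congrFun h b
  · intro z _ hz
    have : ¬ ∀ j, j ≠ b → z j = y j := fun h =>
      hz ⟨z b, by simp, (eq_update_of_agree h).symm⟩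
    simp [blockGate, this]
  · intro i _
    have : ∀ j, j ≠ b → update y b i j = y j := fun j hj => by simp [hj]
    simp only [blockGate, Matrix.of_apply, if_pos this, update_self]

theorem blockGate_one (t : Fin k) : blockGate t (fun _ => 1) = 1 := by
  ext x y
  simp only [blockGate, Matrix.of_apply, Matrix.one_apply]
  by_cases h : ∀ j, j ≠ t → x j = y j
  · rw [if_pos h]
    refine if_congr ⟨fun ht => ?_, fun hxy => by rw [hxy]⟩ rfl rfl
    rw [eq_update_of_agree h, ht, update_eq_self]
  · rw [if_neg h, if_neg]
    rintro rfl
    exact h fun _ _ => rfl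

/-- `N` has already changed bit `t` when `M` is selected, so `M` must not look at that bit. -/
theorem blockGate_mul {t : Fin k} {M N : (Fin k → Fin 2) → Matrix (Fin 2) (Fin 2) ℂ}
    (hM : IndepOf t M) :
    blockGate t M * blockGate t N = blockGate t fun y => M y * N y := by
  ext x y
  rw [mul_blockGate_apply]
  simp only [blockGate, Matrix.of_apply, Matrix.mul_apply, hM y, update_self]
  by_cases h : ∀ j, j ≠ t → x j = y j
  · rw [if_pos h]
    refine Finset.sum_congr rfl fun i _ => ?_
    rw [if_pos fun j hj => by simp [hj, h j hj]]
  · rw [if_neg h]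
    refine Finset.sum_eq_zero fun i _ => ?_
    rw [if_neg, zero_mul]
    exact fun h' => h fun j hj => by simpa [hj] using h' j hj

/-- Moving an operator on qubit `t` through a gate on another qubit `b` that is, up to phases,
a classical toggle of `b`. -/
theorem blockGate_mul_monomial {t b : Fin k} (htb : t ≠ b)
    {M N : (Fin k → Fin 2) → Matrix (Fin 2) (Fin 2) ℂ} {h : (Fin k → Fin 2) → Fin 2}
    (hM : IndepOf t M)
    (hmon : ∀ y i j, M y i j ≠ 0 → i = j + h y) :
    blockGate t N * blockGate b M =
      blockGate b M * blockGate t fun y => N (update y b (y b + h y)) := by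
  ext x y
  rw [mul_blockGate_apply, mul_blockGate_apply, Fintype.sum_eq_single (x b),
    Fintype.sum_eq_single (x t)]
  · simp only [blockGate, Matrix.of_apply, hM y]
    have e : (∀ j, j ≠ t → x j = update y b (x b) j) ↔
        ∀ j, j ≠ b → x j = update y t (x t) j := by
      refine forall_congr' fun j => ?_
      by_cases h1 : j = t <;> by_cases h2 : j = b <;> simp [h1, h2, htb, htb.symm]
    rw [if_congr e rfl rfl, update_of_ne htb, update_of_ne htb.symm]
    split_ifs with hc
    · by_cases h0 : M y (x b) (y b) = 0
      · simp [h0]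
      · rw [← hmon y _ _ h0, mul_comm]
    · simp
  · intro i hi
    simp only [blockGate, Matrix.of_apply]
    rw [if_neg, zero_mul]
    exact fun h' => hi (by simpa [htb] using (h' t htb).symm)
  · intro i hi
    simp only [blockGate, Matrix.of_apply]
    rw [if_neg, zero_mul]
    exact fun h' => hi (by simpa [htb.symm] using (h' b htb.symm).symm)

/-! ### Circuits with a single target, inverses and gate counts -/

/-- The qubit on which an elementary gate acts. -/
def Gate.target : Gate k → Fin k
  | .cnot _ t _ => t
  | .T t => t
  | .Tdg t => t
  | .H t => t
  | .Rz _ t => t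

/-- The single-qubit operator that a gate applies to its target. -/
def Gate.mat : Gate k → (Fin k → Fin 2) → Matrix (Fin 2) (Fin 2) ℂ
  | .cnot c _ _, y => if y c = 1 then matX else 1
  | .T _, _ => matT
  | .Tdg _, _ => matTdg
  | .H _, _ => matH
  | .Rz θ _, _ => matRz θ

theorem Gate.toOperator_eq (g : Gate k) : g.toOperator = blockGate g.target g.mat := by
  cases g <;> simp [Gate.toOperator, controlledGate_eq_blockGate, Gate.target] <;> rfl

theorem Gate.indepOf_mat (g : Gate k) {t : Fin k} (h : g.target = t ∨ t ∉ g.support) :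
    IndepOf t g.mat := by
  intro y b
  cases g with
  | cnot c s hcs =>
    have : c ≠ t := by
      rcases h with h | h
      · exact fun e => hcs (e.trans h.symm)
      · simp only [Gate.support, Finset.mem_insert, not_or] at h
        exact fun e => h.1 e.symm
    simp [Gate.mat, this]
  | _ => rfl

/-- The product of the single-qubit operators of the gates of a circuit. -/
def Circuit.mat : Circuit k → (Fin k → Fin 2) → Matrix (Fin 2) (Fin 2) ℂ
  | [], _ => 1
  | g :: D, y => Circuit.mat D y * g.mat y

theorem Circuit.indepOf_mat {D : Circuit k} {t : Fin k}
    (h : ∀ g ∈ D, g.target = t ∨ t ∉ g.support) : IndepOf t D.mat := by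
  induction D with
  | nil => exact fun _ _ => rfl
  | cons g D ih =>
    intro y b
    simp only [Circuit.mat]
    rw [ih (fun g' hg' => h g' (List.mem_cons_of_mem _ hg')) y b,
      g.indepOf_mat (h g List.mem_cons_self) y b]

/-- With a common target no gate alters a control of another, so all gates may be evaluated at the
initial bit string. -/
theorem Circuit.toOperator_eq {D : Circuit k} {t : Fin k} (h : ∀ g ∈ D, g.target = t) :
    D.toOperator = blockGate t D.mat := by
  induction D with
  | nil => exact (blockGate_one t).symm
  | cons g D ih =>
    have hD : ∀ g' ∈ D, g'.target = t := fun g' hg' => h g' (List.mem_cons_of_mem _ hg')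
    rw [Circuit.toOperator, ih hD, g.toOperator_eq, h g List.mem_cons_self,
      blockGate_mul (Circuit.indepOf_mat fun g' hg' => Or.inl (hD g' hg'))]
    rfl

theorem Circuit.toOperator_append (D E : Circuit k) :
    Circuit.toOperator (D ++ E) = Circuit.toOperator E * Circuit.toOperator D := by
  induction D with
  | nil => simp [Circuit.toOperator]
  | cons g D ih => rw [List.cons_append, Circuit.toOperator, ih, Circuit.toOperator, mul_assoc]

theorem matX_mul_matX : matX * matX = 1 := by
  ext i j; fin_cases i <;> fin_cases j <;> simp [matX]

theorem sqrt_two_sq_complex : ((Real.sqrt 2 : ℝ) : ℂ) ^ 2 = 2 := by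
  norm_cast
  simp

theorem matH_mul_matH : matH * matH = 1 := by
  have h := sqrt_two_sq_complex
  have h0 : ((Real.sqrt 2 : ℝ) : ℂ) ≠ 0 := by simp
  ext i j; fin_cases i <;> fin_cases j <;> simp [matH] <;> field_simp <;> rw [h] <;> norm_num

theorem matT_mul_matTdg : matT * matTdg = 1 := by
  ext i j; fin_cases i <;> fin_cases j <;> simp [matT, matTdg, ← Complex.exp_add]

theorem matTdg_mul_matT : matTdg * matT = 1 := by
  ext i j; fin_cases i <;> fin_cases j <;> simp [matT, matTdg, ← Complex.exp_add]

theorem matRz_add (θ φ : ℝ) : matRz θ * matRz φ = matRz (θ + φ) := by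
  ext i j; fin_cases i <;> fin_cases j <;> simp [matRz, ← Complex.exp_add] <;> ring_nf

theorem matRz_zero : matRz 0 = 1 := by
  ext i j; fin_cases i <;> fin_cases j <;> simp [matRz]

/-- The inverse gate. -/
def Gate.inv : Gate k → Gate k
  | .cnot c t h => .cnot c t h
  | .T t => .Tdg t
  | .Tdg t => .T t
  | .H t => .H t
  | .Rz θ t => .Rz (-θ) t

theorem Gate.inv_mul (g : Gate k) : g.inv.toOperator * g.toOperator = 1 := by
  have ht : g.inv.target = g.target := by cases g <;> rfl
  rw [Gate.toOperator_eq, Gate.toOperator_eq, ht,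
    blockGate_mul (ht ▸ g.inv.indepOf_mat (Or.inl rfl)), ← blockGate_one g.target]
  congr 1
  funext y
  cases g <;> simp only [Gate.inv, Gate.mat, matH_mul_matH, matT_mul_matTdg, matTdg_mul_matT,
    matRz_add, neg_add_cancel, matRz_zero]
  split_ifs
  · exact matX_mul_matX
  · exact mul_one 1

/-- The inverse circuit. -/
def Circuit.inv (D : Circuit k) : Circuit k := (D.map Gate.inv).reverse

theorem Circuit.inv_mul (D : Circuit k) : D.inv.toOperator * D.toOperator = 1 := by
  induction D with
  | nil => simp [Circuit.inv, Circuit.toOperator]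
  | cons g D ih =>
    have : Circuit.inv (g :: D) = Circuit.inv D ++ [g.inv] := by simp [Circuit.inv]
    rw [this, Circuit.toOperator_append, Circuit.toOperator]
    simp only [Circuit.toOperator, one_mul]
    rw [mul_assoc, ← mul_assoc (Circuit.inv D).toOperator, ih, one_mul, g.inv_mul]

theorem Circuit.usesOnly_inv {D : Circuit k} {S : Finset (Fin k)} (h : D.UsesOnly S) :
    D.inv.UsesOnly S := by
  intro g hg
  simp only [Circuit.inv, List.mem_reverse, List.mem_map] at hg
  obtain ⟨g', hg', rfl⟩ := hg
  have := h g' hg'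
  cases g' <;> exact this

theorem Circuit.usesOnly_append {D E : Circuit k} {S : Finset (Fin k)} (hD : D.UsesOnly S)
    (hE : E.UsesOnly S) : Circuit.UsesOnly (D ++ E) S := by
  intro g hg
  rcases List.mem_append.1 hg with h | h
  exacts [hD g h, hE g h]

theorem Circuit.UsesOnly.mono {D : Circuit k} {S S' : Finset (Fin k)} (h : D.UsesOnly S)
    (hS : S ⊆ S') : D.UsesOnly S' := fun g hg => (h g hg).trans hS

/-- Bounds on the numbers of CNOT, `T`, Hadamard and `R_z` gates of a circuit. -/
def Circuit.CostLE (D : Circuit k) (nCX nT nH nRz : ℕ) : Prop :=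
  D.cnotCount ≤ nCX ∧ D.tCount ≤ nT ∧ D.hCount ≤ nH ∧ D.rzCount ≤ nRz

theorem Circuit.CostLE.append {D E : Circuit k} {a b c d a' b' c' d' : ℕ}
    (hD : D.CostLE a b c d) (hE : E.CostLE a' b' c' d') :
    Circuit.CostLE (D ++ E) (a + a') (b + b') (c + c') (d + d') := by
  simp only [Circuit.CostLE, Circuit.cnotCount, Circuit.tCount, Circuit.hCount, Circuit.rzCount,
    List.countP_append] at *
  omega

theorem Circuit.CostLE.inv {D : Circuit k} {a b c d : ℕ} (hD : D.CostLE a b c d) :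
    D.inv.CostLE a b c d := by
  have h1 : Gate.isCnot ∘ Gate.inv (k := k) = Gate.isCnot := by funext g; cases g <;> rfl
  have h2 : Gate.isT ∘ Gate.inv (k := k) = Gate.isT := by funext g; cases g <;> rfl
  have h3 : Gate.isH ∘ Gate.inv (k := k) = Gate.isH := by funext g; cases g <;> rfl
  have h4 : Gate.isRz ∘ Gate.inv (k := k) = Gate.isRz := by funext g; cases g <;> rfl
  simpa [Circuit.CostLE, Circuit.cnotCount, Circuit.tCount, Circuit.hCount, Circuit.rzCount,
    Circuit.inv, List.countP_map, h1, h2, h3, h4] using hD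

theorem Circuit.CostLE.mono {D : Circuit k} {a b c d a' b' c' d' : ℕ} (hD : D.CostLE a b c d)
    (ha : a ≤ a') (hb : b ≤ b') (hc : c ≤ c') (hd : d ≤ d') : D.CostLE a' b' c' d' :=
  ⟨hD.1.trans ha, hD.2.1.trans hb, hD.2.2.1.trans hc, hD.2.2.2.trans hd⟩

/-! ### Circuits that are classical permutations up to phases -/

/-- Up to phases, the circuit `D` acts on the qubits of `S` as the classical map `g`: operators on
other qubits that are controlled by the register can be moved through `D`. -/
structure Permutes (S : Finset (Fin k)) (D : Circuit k)
    (g : (Fin k → Fin 2) → Fin k → Fin 2) : Prop where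
  usesOnly : D.UsesOnly S
  conj : ∀ t ∉ S, ∀ N, IndepOf t N →
    blockGate t N * D.toOperator = D.toOperator * blockGate t fun y => N (g y)
  comm : ∀ t ∉ S, ∀ y b, g (update y t b) = update (g y) t b
  fix : ∀ t ∉ S, ∀ y, g y t = y t

theorem Permutes.append {S : Finset (Fin k)} {D E : Circuit k}
    {f g : (Fin k → Fin 2) → Fin k → Fin 2} (hD : Permutes S D f) (hE : Permutes S E g) :
    Permutes S (D ++ E) fun y => g (f y) where
  usesOnly := Circuit.usesOnly_append hD.usesOnly hE.usesOnly
  conj t ht N hN := by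
    rw [Circuit.toOperator_append, ← mul_assoc, hE.conj t ht N hN, mul_assoc,
      hD.conj t ht (fun y => N (g y)) (fun y b => by simp only [hE.comm t ht, hN _ _]), mul_assoc]
  comm t ht y b := by rw [hD.comm t ht, hE.comm t ht]
  fix t ht y := by rw [hE.fix t ht, hD.fix t ht]

theorem Permutes.mono {S S' : Finset (Fin k)} {D : Circuit k}
    {g : (Fin k → Fin 2) → Fin k → Fin 2} (h : Permutes S D g) (hS : S ⊆ S') :
    Permutes S' D g where
  usesOnly := h.usesOnly.mono hS
  conj t ht := h.conj t fun h' => ht (hS h')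
  comm t ht := h.comm t fun h' => ht (hS h')
  fix t ht := h.fix t fun h' => ht (hS h')

theorem Permutes.of_monomial {S : Finset (Fin k)} {D : Circuit k} {b : Fin k}
    {h : (Fin k → Fin 2) → Fin 2} (hb : b ∈ S) (hD : ∀ g ∈ D, g.target = b)
    (hS : D.UsesOnly S) (hh : ∀ t ∉ S, IndepOf t h)
    (hmon : ∀ y i j, D.mat y i j ≠ 0 → i = j + h y) :
    Permutes S D fun y => update y b (y b + h y) where
  usesOnly := hS
  conj t ht N _ := by
    rw [Circuit.toOperator_eq hD]
    refine blockGate_mul_monomial (ne_of_mem_of_not_mem hb ht).symm ?_ hmon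
    exact Circuit.indepOf_mat fun g hg => Or.inr fun h' => ht (hS g hg h')
  comm t ht y c := by
    have : b ≠ t := ne_of_mem_of_not_mem hb ht
    rw [hh t ht, update_of_ne this, update_comm this.symm]
  fix t ht y := update_of_ne (ne_of_mem_of_not_mem hb ht).symm _ _

/-! ### Relative-phase Toffoli gates -/

theorem matH_conj (a b c d : ℂ) :
    matH * !![a, b; c, d] * matH =
      !![(a + b + c + d) / 2, (a - b + c - d) / 2; (a + b - c - d) / 2, (a - b - c + d) / 2] := by
  have h := sqrt_two_sq_complex
  have h0 : ((Real.sqrt 2 : ℝ) : ℂ) ≠ 0 := by simp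
  ext i j; fin_cases i <;> fin_cases j <;> simp [matH, Matrix.mul_apply] <;> field_simp <;>
    rw [h] <;> ring

theorem exp_I_mul_pi_div_four_mul_self : Complex.exp (Complex.I * (Real.pi / 4)) *
    Complex.exp (Complex.I * (Real.pi / 4)) = Complex.I := by
  rw [← sq, ← Complex.exp_nat_mul]
  refine Eq.trans ?_ Complex.exp_pi_div_two_mul_I
  congr 1; push_cast; ring

theorem exp_neg_I_mul_pi_div_four_mul_self : Complex.exp (-(Complex.I * (Real.pi / 4))) *
    Complex.exp (-(Complex.I * (Real.pi / 4))) = -Complex.I := by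
  rw [Complex.exp_neg, ← mul_inv, exp_I_mul_pi_div_four_mul_self, Complex.inv_I]

theorem exp_mul_exp_neg_pi_div_four : Complex.exp (Complex.I * (Real.pi / 4)) *
    Complex.exp (-(Complex.I * (Real.pi / 4))) = 1 := by
  rw [← Complex.exp_add, add_neg_cancel, Complex.exp_zero]

theorem fin_two_one_add_one : (1 : Fin 2) + 1 = 0 := rfl

theorem fin_two_cases (i : Fin 2) : i = 0 ∨ i = 1 := by omega

/-- The relative-phase Toffoli gate that toggles `b` if `a` and `c` are both `1`. -/
theorem exists_permutes_and {a c b : Fin k} (ha : a ≠ b) (hc : c ≠ b) :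
    ∃ D : Circuit k, D.CostLE 3 4 2 0 ∧
      Permutes {a, c, b} D fun y => update y b (y b + y a * y c) := by
  refine ⟨[.H b, .T b, .cnot a b ha, .Tdg b, .cnot c b hc, .T b, .cnot a b ha, .Tdg b, .H b],
    ⟨le_rfl, le_rfl, le_rfl, le_rfl⟩,
    Permutes.of_monomial (by simp) (by simp [Gate.target])
      (by simp [Circuit.UsesOnly, Gate.support, Finset.insert_subset_iff]) ?_ ?_⟩
  · intro t ht y e
    simp only [Finset.mem_insert, Finset.mem_singleton, not_or] at ht
    simp only [update_of_ne (Ne.symm ht.1), update_of_ne (Ne.symm ht.2.1)]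
  · intro y i j
    have e : Circuit.mat [.H b, .T b, .cnot a b ha, .Tdg b, .cnot c b hc, .T b, .cnot a b ha,
        .Tdg b, .H b] y = matH * (matTdg * (if y a = 1 then matX else 1) * matT *
          (if y c = 1 then matX else 1) * matTdg * (if y a = 1 then matX else 1) * matT) *
          matH := by
      simp only [Circuit.mat, Gate.mat, one_mul, mul_assoc]
    rw [e]
    have h1 := exp_I_mul_pi_div_four_mul_self
    have h2 := exp_neg_I_mul_pi_div_four_mul_self
    have h3 := exp_mul_exp_neg_pi_div_four
    simp only [matT, matTdg, matX, Matrix.one_fin_two]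
    -- Only w² = i, v² = -i and wv = 1 matter; what remains is a finite check over the control bits
    -- and matrix entries.
    generalize Complex.exp (Complex.I * (Real.pi / 4)) = w at *
    generalize Complex.exp (-(Complex.I * (Real.pi / 4))) = v at *
    rcases fin_two_cases (y a) with h | h <;> rcases fin_two_cases (y c) with h' | h' <;>
      fin_cases i <;> fin_cases j <;>
      norm_num [h, h', fin_two_one_add_one, matH_conj, mul_comm v w, h3, h1, h2]

/-- The relative-phase Toffoli gate that toggles `b` if `a` and `c` are both `0`. -/
theorem exists_permutes_nor {a c b : Fin k} (ha : a ≠ b) (hc : c ≠ b) :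
    ∃ D : Circuit k, D.CostLE 3 4 2 0 ∧
      Permutes {a, c, b} D fun y => update y b (y b + (1 + y a) * (1 + y c)) := by
  -- With `T` in place of every inverse, both controls at 0 give T⁴ = Z between the Hadamards, hence
  -- the toggle.
  refine ⟨[.H b, .T b, .cnot a b ha, .T b, .cnot c b hc, .T b, .cnot a b ha, .T b, .H b],
    ⟨le_rfl, le_rfl, le_rfl, le_rfl⟩,
    Permutes.of_monomial (by simp) (by simp [Gate.target])
      (by simp [Circuit.UsesOnly, Gate.support, Finset.insert_subset_iff]) ?_ ?_⟩
  · intro t ht y e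
    simp only [Finset.mem_insert, Finset.mem_singleton, not_or] at ht
    simp only [update_of_ne (Ne.symm ht.1), update_of_ne (Ne.symm ht.2.1)]
  · intro y i j
    have e : Circuit.mat [.H b, .T b, .cnot a b ha, .T b, .cnot c b hc, .T b, .cnot a b ha,
        .T b, .H b] y = matH * (matT * (if y a = 1 then matX else 1) * matT *
          (if y c = 1 then matX else 1) * matT * (if y a = 1 then matX else 1) * matT) *
          matH := by
      simp only [Circuit.mat, Gate.mat, one_mul, mul_assoc]
    rw [e]
    have h1 := exp_I_mul_pi_div_four_mul_self
    have h4 : Complex.I * Complex.exp (Complex.I * (Real.pi / 4)) *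
        Complex.exp (Complex.I * (Real.pi / 4)) = -1 := by rw [mul_assoc, h1, Complex.I_mul_I]
    simp only [matT, matX, Matrix.one_fin_two]
    generalize Complex.exp (Complex.I * (Real.pi / 4)) = w at *
    rcases fin_two_cases (y a) with h | h <;> rcases fin_two_cases (y c) with h' | h' <;>
      fin_cases i <;> fin_cases j <;>
      norm_num [h, h', fin_two_one_add_one, matH_conj, h1, h4]

/-- A Toffoli gate with negated controls, up to a phase that depends only on the controls. -/
theorem exists_mat_eq_nor {a c b : Fin k} (ha : a ≠ b) (hc : c ≠ b) :
    ∃ D : Circuit k, D.CostLE 4 4 2 0 ∧ (∀ g ∈ D, g.target = b) ∧ D.UsesOnly {a, c, b} ∧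
      ∀ y, D.mat y = if y a = 0 ∧ y c = 0 then matX else Complex.I • 1 := by
  -- The extra CNOT removes the Z that would otherwise remain on the target when `c` is 1, leaving a
  -- scalar phase.
  refine ⟨[.H b, .T b, .cnot a b ha, .T b, .cnot c b hc, .T b, .cnot a b ha, .T b,
    .cnot c b hc, .H b], ⟨le_rfl, le_rfl, le_rfl, le_rfl⟩, by simp [Gate.target],
    by simp [Circuit.UsesOnly, Gate.support, Finset.insert_subset_iff], fun y => ?_⟩
  have e : Circuit.mat [.H b, .T b, .cnot a b ha, .T b, .cnot c b hc, .T b, .cnot a b ha,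
      .T b, .cnot c b hc, .H b] y = matH * ((if y c = 1 then matX else 1) * matT *
        (if y a = 1 then matX else 1) * matT * (if y c = 1 then matX else 1) * matT *
        (if y a = 1 then matX else 1) * matT) * matH := by
    simp only [Circuit.mat, Gate.mat, one_mul, mul_assoc]
  rw [e]
  have h1 := exp_I_mul_pi_div_four_mul_self
  have h4 : Complex.I * Complex.exp (Complex.I * (Real.pi / 4)) *
      Complex.exp (Complex.I * (Real.pi / 4)) = -1 := by rw [mul_assoc, h1, Complex.I_mul_I]
  simp only [matT, matX, Matrix.one_fin_two]
  generalize Complex.exp (Complex.I * (Real.pi / 4)) = w at *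
  rcases fin_two_cases (y a) with h | h <;> rcases fin_two_cases (y c) with h' | h' <;>
    ext i j <;> fin_cases i <;> fin_cases j <;>
    norm_num [h, h', matH_conj, h1, h4]

theorem permutes_cnot {c b : Fin k} (h : c ≠ b) :
    Permutes {c, b} [.cnot c b h] fun y => update y b (y b + y c) := by
  refine Permutes.of_monomial (by simp) (by simp [Gate.target])
    (by simp [Circuit.UsesOnly, Gate.support]) ?_ ?_
  · intro t ht y e
    simp only [Finset.mem_insert, Finset.mem_singleton, not_or] at ht
    exact update_of_ne (Ne.symm ht.1) _ _
  · intro y i j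
    rcases fin_two_cases (y c) with h | h <;> fin_cases i <;> fin_cases j <;>
      simp [Circuit.mat, Gate.mat, h, matX]

/-! ### The ladder and the conditional controlled X -/

/-- Starting from 1, `u` drops to 0 exactly when `x₁` and `x₂` are 1; then adding `w` to `x₁` gives
0 exactly when `w` is 1. Allowing `w = x₂` covers the empty list. -/
theorem exists_ladder_base {u x₁ x₂ w : Fin k} (h₁ : u ≠ x₁) (h₂ : u ≠ x₂) (hw : u ≠ w)
    (h₁w : x₁ ≠ w) :
    ∃ (D : Circuit k) (g : (Fin k → Fin 2) → Fin k → Fin 2),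
      D.CostLE 4 4 2 0 ∧ Permutes {u, x₁, x₂, w} D g ∧
      ∀ y, y u = 1 → ((g y u = 0 ∧ g y x₁ = 0) ↔ y x₁ = 1 ∧ y x₂ = 1 ∧ y w = 1) := by
  obtain ⟨D, hDc, hD⟩ := exists_permutes_and h₁.symm h₂.symm
  have hE := permutes_cnot h₁w.symm
  refine ⟨_, _, hDc.append (E := [.cnot w x₁ h₁w.symm]) (a' := 1) (b' := 0) (c' := 0) (d' := 0)
    ⟨le_rfl, le_rfl, le_rfl, le_rfl⟩,
    (hD.mono ?_).append (hE.mono ?_), ?_⟩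
  · intro j; simp; tauto
  · intro j; simp; tauto
  · intro y hy
    simp only [update_self, update_of_ne h₁, update_of_ne h₁.symm, update_of_ne hw.symm, hy]
    rcases fin_two_cases (y x₁) with a | a <;> rcases fin_two_cases (y x₂) with b | b <;>
      rcases fin_two_cases (y w) with c | c <;> simp [a, b, c, fin_two_one_add_one]

/-- Up to phases, a circuit with one relative-phase Toffoli gate per qubit that collects the
conjunction of the bits of a list in two qubits, provided that the qubit `u` is in state `1`. -/
theorem exists_ladder : ∀ (l : List (Fin k)) (u x₁ x₂ : Fin k), (u :: x₁ :: x₂ :: l).Nodup →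
    ∃ (D : Circuit k) (g : (Fin k → Fin 2) → Fin k → Fin 2),
      D.CostLE (3 * l.length + 4) (4 * l.length + 4) (2 * l.length + 2) 0 ∧
      Permutes (u :: x₁ :: x₂ :: l).toFinset D g ∧
      ∀ y, y u = 1 →
        ((g y u = 0 ∧ g y x₁ = 0) ↔ ∀ j ∈ x₁ :: x₂ :: l, y j = 1)
  | [], u, x₁, x₂, h => by
    simp only [List.nodup_cons, List.mem_cons, not_or, List.not_mem_nil, not_false_eq_true] at h
    obtain ⟨D, g, hc, hp, hg⟩ := exists_ladder_base h.1.1 h.1.2.1 h.1.2.1 h.2.1.1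
    refine ⟨D, g, hc, hp.mono ?_, fun y hy => ?_⟩
    · intro j; simp
    · rw [hg y hy]; simp
  | [w], u, x₁, x₂, h => by
    simp only [List.nodup_cons, List.mem_cons, not_or, List.not_mem_nil, not_false_eq_true] at h
    obtain ⟨D, g, hc, hp, hg⟩ := exists_ladder_base h.1.1 h.1.2.1 h.1.2.2.1 h.2.1.2.1
    refine ⟨D, g, hc.mono (by simp) (by simp) (by simp) le_rfl, hp.mono ?_, fun y hy => ?_⟩
    · intro j; simp
    · rw [hg y hy]; simp
  | x₃ :: x₄ :: l, u, x₁, x₂, h => by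
    obtain ⟨h₀, h₁, h'⟩ : u ∉ x₁ :: x₂ :: x₃ :: x₄ :: l ∧ x₁ ∉ x₂ :: x₃ :: x₄ :: l ∧
      (x₂ :: x₃ :: x₄ :: l).Nodup := by simpa only [List.nodup_cons] using h
    -- Here `x₂` takes over the role of `u`. Two Toffoli gates are added for two list entries.
    obtain ⟨E, g, hEc, hE, hg⟩ := exists_ladder l x₂ x₃ x₄ h'
    have hu₁ : u ≠ x₁ := fun e => h₀ (by simp [e])
    have hu₂ : u ≠ x₂ := fun e => h₀ (by simp [e])
    have h₁₂ : x₁ ≠ x₂ := fun e => h₁ (by simp [e])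
    have h₁₃ : x₁ ≠ x₃ := fun e => h₁ (by simp [e])
    obtain ⟨D, hDc, hD⟩ := exists_permutes_and hu₁.symm hu₂.symm
    obtain ⟨F, hFc, hF⟩ := exists_permutes_nor h₁₂.symm h₁₃.symm
    refine ⟨_, _, ((hDc.append hEc).append hFc).mono ?_ ?_ ?_ le_rfl,
      ((hD.mono ?_).append (hE.mono ?_)).append (hF.mono ?_), fun y hy => ?_⟩
    · simp only [List.length_cons]; omega
    · simp only [List.length_cons]; omega
    · simp only [List.length_cons]; omega
    · intro j; simp; tauto
    · intro j; simp; tauto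
    · intro j; simp; tauto
    · set y₁ := update y u (y u + y x₁ * y x₂) with hy₁
      have e : ∀ j, j ≠ u → y₁ j = y j := fun j hj => update_of_ne hj _ _
      have eu : y₁ u = 1 + y x₁ * y x₂ := by rw [hy₁, update_self, hy]
      have gu : g y₁ u = y₁ u := hE.fix u (fun h => h₀ (List.mem_cons_of_mem _
        (List.mem_toFinset.1 h))) y₁
      have g₁ : g y₁ x₁ = y₁ x₁ := hE.fix x₁ (fun h => h₁ (List.mem_toFinset.1 h)) y₁
      rw [update_self, update_of_ne hu₁, gu, g₁, eu, e x₁ hu₁.symm]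
      have hl : (∀ j ∈ x₃ :: x₄ :: l, y₁ j = 1) ↔ ∀ j ∈ x₃ :: x₄ :: l, y j = 1 :=
        forall₂_congr fun j hj => by
          rw [e j fun h => h₀ (by rw [← h]; exact List.mem_cons_of_mem _ (List.mem_cons_of_mem _ hj))]
      rw [List.forall_mem_cons, List.forall_mem_cons, ← hl]
      -- If `x₁` or `x₂` is 0 then `u` stays 1 and both sides fail. Otherwise `x₂` is 1, as the
      -- recursion requires, and the last gate clears `x₁` exactly when the rest is all 1.
      rcases fin_two_cases (y x₁) with a | a
      · simp [a]
      rcases fin_two_cases (y x₂) with b | b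
      · simp [b]
      rw [← hg y₁ ((e x₂ hu₂.symm).trans b)]
      rcases fin_two_cases (g y₁ x₂) with c | c <;> rcases fin_two_cases (g y₁ x₃) with d | d <;>
        simp [a, b, c, d, fin_two_one_add_one]

/-- The multi-controlled `X` with control set `C`, up to phases on the control qubits, on the
states in which the control `u` is in state `1`. -/
theorem exists_conditional_controlled_X {C : Finset (Fin k)} {u t : Fin k} (hu : u ∈ C)
    (ht : t ∉ C) :
    ∃ (D : Circuit k) (F : (Fin k → Fin 2) → Prop) (ph : (Fin k → Fin 2) → ℂ)
      (_ : DecidablePred F),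
      D.CostLE (6 * C.card + 4) (8 * C.card + 4) (4 * C.card + 2) 0 ∧
      D.UsesOnly (insert t C) ∧
      D.toOperator = blockGate t (fun y => ph y • if F y then matX else 1) ∧
      (∀ y, ph y ≠ 0) ∧ IndepOf t F ∧ IndepOf t ph ∧
      ∀ y, y u = 1 → (F y ↔ ∀ j ∈ C, y j = 1) := by
  obtain ⟨l, hl, hlC⟩ : ∃ l : List (Fin k), l.Nodup ∧ l.toFinset = C.erase u :=
    ⟨(C.erase u).toList, Finset.nodup_toList _, Finset.toList_toFinset _⟩
  have hC : C = (u :: l).toFinset := by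
    rw [List.toFinset_cons, hlC, Finset.insert_erase hu]
  have hnd : (u :: l).Nodup := by
    rw [List.nodup_cons, ← List.mem_toFinset, hlC]
    exact ⟨Finset.notMem_erase u C, hl⟩
  have hall : ∀ y : Fin k → Fin 2, y u = 1 → ((∀ j ∈ C, y j = 1) ↔ ∀ j ∈ l, y j = 1) := by
    intro y hy
    rw [hC]; simp [hy]
  -- With at most two controls, the condition given `u = 1` is a single bit, and one CNOT suffices.
  have small : ∀ w ∈ C, (∀ y : Fin k → Fin 2, y u = 1 → (y w = 1 ↔ ∀ j ∈ C, y j = 1)) →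
      ∃ (D : Circuit k) (F : (Fin k → Fin 2) → Prop) (ph : (Fin k → Fin 2) → ℂ)
      (_ : DecidablePred F),
      D.CostLE (6 * C.card + 4) (8 * C.card + 4) (4 * C.card + 2) 0 ∧
      D.UsesOnly (insert t C) ∧
      D.toOperator = blockGate t (fun y => ph y • if F y then matX else 1) ∧
      (∀ y, ph y ≠ 0) ∧ IndepOf t F ∧ IndepOf t ph ∧
      ∀ y, y u = 1 → (F y ↔ ∀ j ∈ C, y j = 1) := by
    intro w hw h
    have hwt : w ≠ t := ne_of_mem_of_not_mem hw ht
    refine ⟨[.cnot w t hwt], fun y => y w = 1, fun _ => 1, fun _ => inferInstance,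
      Circuit.CostLE.mono (a := 1) (b := 0) (c := 0) (d := 0) ⟨le_rfl, le_rfl, le_rfl, le_rfl⟩
        (by omega) (by omega) (by omega) le_rfl, ?_, ?_, by simp, ?_, fun _ _ => rfl, h⟩
    · simp [Circuit.UsesOnly, Gate.support, Finset.insert_subset_iff, hw]
    · rw [Circuit.toOperator_eq (t := t) (by simp [Gate.target])]
      simp [Circuit.mat, Gate.mat]
    · intro y b
      simp [hwt]
  match l, hC, hnd, hall with
  | [], hC, hnd, hall => exact small u hu fun y hy => by simp [hall y hy, hy]
  | [w], hC, hnd, hall => exact small w (by simp [hC]) fun y hy => by simp [hall y hy]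
  | x₁ :: x₂ :: l, hC, hnd, hall =>
    obtain ⟨D, g, hDc, hD, hg⟩ := exists_ladder l u x₁ x₂ hnd
    rw [← hC] at hD
    have hut : u ≠ t := ne_of_mem_of_not_mem hu ht
    have h₁C : x₁ ∈ C := by simp [hC]
    have h₁t : x₁ ≠ t := ne_of_mem_of_not_mem h₁C ht
    obtain ⟨E, hEc, hEt, hE, hEm⟩ := exists_mat_eq_nor hut h₁t
    have hcard : C.card = l.length + 3 := by
      rw [hC, List.toFinset_card_of_nodup hnd]; rfl
    have hEind : IndepOf t E.mat := Circuit.indepOf_mat fun g hg => Or.inl (hEt g hg)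
    have gind : ∀ (α : Type) (f : Fin 2 → Fin 2 → α),
        IndepOf t fun y => f (g y u) (g y x₁) := fun α f y b => by
      simp only [hD.comm t ht, update_of_ne hut, update_of_ne h₁t]
    refine ⟨D ++ E ++ Circuit.inv D, fun y => g y u = 0 ∧ g y x₁ = 0,
      fun y => if g y u = 0 ∧ g y x₁ = 0 then 1 else Complex.I, fun _ => inferInstance,
      ((hDc.append hEc).append hDc.inv).mono (by omega) (by omega) (by omega) le_rfl,
      Circuit.usesOnly_append (Circuit.usesOnly_append (hD.usesOnly.mono ?_) (hE.mono ?_))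
        (Circuit.usesOnly_inv (hD.usesOnly.mono ?_)), ?_, ?_,
      gind Prop fun a b => a = 0 ∧ b = 0,
      gind ℂ fun a b => if a = 0 ∧ b = 0 then 1 else Complex.I,
      fun y hy => (hg y hy).trans (hall y hy).symm⟩
    · exact Finset.subset_insert _ _
    · simp [Finset.insert_subset_iff, hu, h₁C]
    · exact Finset.subset_insert _ _
    -- Moving `E` through the ladder replaces its controls by their images under `g`; the ladder
    -- then cancels its inverse, phases included.
    · rw [Circuit.toOperator_append, Circuit.toOperator_append, Circuit.toOperator_eq hEt,
        hD.conj t ht _ hEind, ← mul_assoc, Circuit.inv_mul, one_mul]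
      congr 1
      funext y
      rw [hEm]
      by_cases h : g y u = 0 ∧ g y x₁ = 0
      · simp only [if_pos h, one_smul]
      · simp only [if_neg h]
    · intro y
      dsimp only
      split_ifs <;> simp

/-! ### Rotations whose axis is chosen by a control, and Euler angles -/

/-- The rotation about the `x` axis by the angle `θ`. -/
def matRx (θ : ℝ) : Matrix (Fin 2) (Fin 2) ℂ :=
  !![Complex.cos (θ / 2), -(Complex.I * Complex.sin (θ / 2));
    -(Complex.I * Complex.sin (θ / 2)), Complex.cos (θ / 2)]

/-- The rotation about the `y` axis by the angle `θ`. -/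
def matRy (θ : ℝ) : Matrix (Fin 2) (Fin 2) ℂ :=
  !![Complex.cos (θ / 2), -Complex.sin (θ / 2); Complex.sin (θ / 2), Complex.cos (θ / 2)]

theorem matRz_eq (θ : ℝ) :
    matRz θ = !![Complex.cos (θ / 2) - Complex.I * Complex.sin (θ / 2), 0;
      0, Complex.cos (θ / 2) + Complex.I * Complex.sin (θ / 2)] := by
  have h1 : Complex.exp (-(Complex.I * (θ / 2))) =
      Complex.cos (θ / 2) - Complex.I * Complex.sin (θ / 2) := by
    rw [← mul_neg, mul_comm, Complex.exp_mul_I, Complex.cos_neg, Complex.sin_neg]; ring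
  have h2 : Complex.exp (Complex.I * (θ / 2)) =
      Complex.cos (θ / 2) + Complex.I * Complex.sin (θ / 2) := by
    rw [mul_comm, Complex.exp_mul_I]; ring
  rw [matRz, h1, h2]

theorem matRx_zero : matRx 0 = 1 := by
  ext i j; fin_cases i <;> fin_cases j <;> simp [matRx]

theorem matRy_zero : matRy 0 = 1 := by
  ext i j; fin_cases i <;> fin_cases j <;> simp [matRy]

theorem matRx_add (θ φ : ℝ) : matRx θ * matRx φ = matRx (θ + φ) := by
  simp only [matRx, Matrix.mul_fin_two, Complex.ofReal_add, add_div, Complex.cos_add,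
    Complex.sin_add]
  ext i j
  fin_cases i <;> fin_cases j <;> simp <;> ring_nf <;> simp [Complex.I_sq] <;> ring

theorem matRy_add (θ φ : ℝ) : matRy θ * matRy φ = matRy (θ + φ) := by
  simp only [matRy, Matrix.mul_fin_two, Complex.ofReal_add, add_div, Complex.cos_add,
    Complex.sin_add]
  ext i j
  fin_cases i <;> fin_cases j <;> simp <;> ring

theorem matX_mul_matRx (θ : ℝ) : matX * matRx θ = matRx θ * matX := by
  simp [matX, matRx]

theorem matX_mul_matRy (θ : ℝ) : matX * matRy θ = matRy (-θ) * matX := by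
  simp [matX, matRy, neg_div]

theorem matX_mul_matRz (θ : ℝ) : matX * matRz θ = matRz (-θ) * matX := by
  simp [matX, matRz, neg_div]

theorem matH_mul_matRz_mul_matH (θ : ℝ) : matH * matRz θ * matH = matRx θ := by
  rw [matRz_eq, matH_conj, matRx]
  ext i j; fin_cases i <;> fin_cases j <;> simp <;> ring

/-- A circuit for a rotation about the `x` axis if `u` is in state `0` and about the `y` axis
if `u` is in state `1`. -/
def rotXY {u t : Fin k} (h : u ≠ t) (θ : ℝ) : Circuit k :=
  [.T t, .cnot u t h, .Tdg t, .H t, .Rz θ t, .H t, .T t, .cnot u t h, .Tdg t]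

/-- A circuit for a rotation about the `x` axis if `u` is in state `0` and about the `z` axis
if `u` is in state `1`. -/
def rotXZ {u t : Fin k} (h : u ≠ t) (θ : ℝ) : Circuit k :=
  [.H t, .T t, .T t, .H t] ++ rotXY h θ ++ [.H t, .Tdg t, .Tdg t, .H t]

theorem Circuit.mat_append (D E : Circuit k) (y : Fin k → Fin 2) :
    Circuit.mat (D ++ E) y = Circuit.mat E y * Circuit.mat D y := by
  induction D with
  | nil => simp [Circuit.mat]
  | cons g D ih => rw [List.cons_append, Circuit.mat, ih, Circuit.mat, mul_assoc]

/-- When `u` is 1, T†XT on both sides acts as a half-turn about the axis of X - Y, which sends x to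
-y; hence the sign in `-θ`. -/
theorem mat_rotXY {u t : Fin k} (h : u ≠ t) (θ : ℝ) (y : Fin k → Fin 2) :
    Circuit.mat (rotXY h θ) y = if y u = 1 then matRy (-θ) else matRx θ := by
  have e : Circuit.mat (rotXY h θ) y = matTdg * (if y u = 1 then matX else 1) * matT *
      (matH * matRz θ * matH) * matTdg * (if y u = 1 then matX else 1) * matT := by
    simp only [rotXY, Circuit.mat, Gate.mat, one_mul, mul_assoc]
  rw [e, matH_mul_matRz_mul_matH]
  split_ifs
  · have h1 := exp_I_mul_pi_div_four_mul_self
    have h2 := exp_neg_I_mul_pi_div_four_mul_self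
    have h3 := exp_mul_exp_neg_pi_div_four
    have hI := Complex.I_mul_I
    simp only [matT, matTdg, matX, matRx, matRy]
    generalize Complex.exp (Complex.I * (Real.pi / 4)) = w at *
    generalize Complex.exp (-(Complex.I * (Real.pi / 4))) = v at *
    simp only [Complex.ofReal_neg, neg_div, Complex.cos_neg, Complex.sin_neg]
    generalize Complex.cos (θ / 2) = c
    generalize Complex.sin (θ / 2) = s
    ext i j; fin_cases i <;> fin_cases j <;> simp
    · linear_combination c * h3
    · linear_combination (-(Complex.I * s)) * h1 - s * hI
    · linear_combination (Complex.I * s) * h2 - s * hI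
    · linear_combination c * h3
  · simp only [mul_one]
    rw [matTdg_mul_matT, one_mul, mul_assoc, matTdg_mul_matT, mul_one]

theorem matT_mul_matT : matT * matT = !![1, 0; 0, Complex.I] := by
  simp [matT, exp_I_mul_pi_div_four_mul_self]

theorem matTdg_mul_matTdg : matTdg * matTdg = !![1, 0; 0, -Complex.I] := by
  simp [matTdg, exp_neg_I_mul_pi_div_four_mul_self]

/-- The outer gates conjugate `rotXY` by a quarter-turn about the x axis, which fixes x and turns -y
into z. -/
theorem mat_rotXZ {u t : Fin k} (h : u ≠ t) (θ : ℝ) (y : Fin k → Fin 2) :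
    Circuit.mat (rotXZ h θ) y = if y u = 1 then matRz θ else matRx θ := by
  have e : Circuit.mat (rotXZ h θ) y = matH * ((matTdg * matTdg) *
      (matH * Circuit.mat (rotXY h θ) y * matH) * (matT * matT)) * matH := by
    simp only [rotXZ, Circuit.mat_append, Circuit.mat, Gate.mat, one_mul, mul_assoc]
  rw [e, mat_rotXY, matT_mul_matT, matTdg_mul_matTdg]
  have hI := Complex.I_mul_I
  split_ifs
  · rw [matRy, matH_conj, Matrix.mul_fin_two, Matrix.mul_fin_two, matH_conj, matRz_eq]
    simp only [Complex.ofReal_neg, neg_div, Complex.cos_neg, Complex.sin_neg]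
    generalize Complex.cos (θ / 2) = c
    generalize Complex.sin (θ / 2) = s
    ext i j; fin_cases i <;> fin_cases j <;> simp
    all_goals first
      | linear_combination (-c / 2) * hI
      | linear_combination c * hI
  · rw [matRx, matH_conj, Matrix.mul_fin_two, Matrix.mul_fin_two, matH_conj]
    generalize Complex.cos (θ / 2) = c
    generalize Complex.sin (θ / 2) = s
    ext i j; fin_cases i <;> fin_cases j <;> simp
    all_goals first
      | linear_combination (-c / 2 - Complex.I * s / 2) * hI
      | linear_combination (c / 2 + Complex.I * s / 2) * hI

/-- Determinant 1 makes the adjoint equal to the adjugate, so the first column determines `W`. Its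
two moduli are the cosine and sine of q/2. -/
theorem exists_euler_angles {W : Matrix (Fin 2) (Fin 2) ℂ}
    (hW : W ∈ Matrix.specialUnitaryGroup (Fin 2) ℂ) :
    ∃ p q r : ℝ, W = matRz p * matRy q * matRz r := by
  obtain ⟨hU, hdet⟩ := Matrix.mem_specialUnitaryGroup_iff.1 hW
  have hadj : star W = W.adjugate := by
    have h1 : star W * W = 1 := Matrix.mem_unitaryGroup_iff'.1 hU
    have h2 := Matrix.mul_adjugate W
    rw [hdet, one_smul] at h2
    calc star W = star W * (W * W.adjugate) := by rw [h2, mul_one]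
      _ = W.adjugate := by rw [← mul_assoc, h1, one_mul]
  rw [Matrix.adjugate_fin_two] at hadj
  have h11 : W 1 1 = (starRingEnd ℂ) (W 0 0) := by
    simpa [Matrix.star_apply] using (congrFun (congrFun hadj 0) 0).symm
  have h01 : W 0 1 = -(starRingEnd ℂ) (W 1 0) := by
    have := congrFun (congrFun hadj 0) 1
    simp [Matrix.star_apply] at this
    rw [this, neg_neg]
  have hsum : ‖W 0 0‖ ^ 2 + ‖W 1 0‖ ^ 2 = 1 := by
    rw [Matrix.det_fin_two, h11, h01, Complex.mul_conj', neg_mul, Complex.conj_mul'] at hdet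
    rw [← Complex.ofReal_inj]
    push_cast
    linear_combination hdet
  have ha := Complex.norm_mul_exp_arg_mul_I (W 0 0)
  have hb := Complex.norm_mul_exp_arg_mul_I (W 1 0)
  have hcos : Real.cos (Real.arccos ‖W 0 0‖) = ‖W 0 0‖ :=
    Real.cos_arccos (by linarith [norm_nonneg (W 0 0)])
      (by nlinarith [norm_nonneg (W 0 0), sq_nonneg ‖W 1 0‖])
  have hsin : Real.sin (Real.arccos ‖W 0 0‖) = ‖W 1 0‖ := by
    rw [Real.sin_arccos, ← hsum, add_sub_cancel_left, Real.sqrt_sq (norm_nonneg _)]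
  have ha' := congrArg (starRingEnd ℂ) ha
  have hb' := congrArg (starRingEnd ℂ) hb
  simp only [map_mul, Complex.conj_ofReal, ← Complex.exp_conj, Complex.conj_I] at ha' hb'
  set α := Complex.arg (W 0 0)
  set β := Complex.arg (W 1 0)
  -- Comparing the phases of the first column gives p + r = -2α and p - r = 2β.
  refine ⟨β - α, 2 * Real.arccos ‖W 0 0‖, -α - β, ?_⟩
  have hc : Complex.cos (((2 * Real.arccos ‖W 0 0‖ : ℝ) : ℂ) / 2) = ‖W 0 0‖ := by
    rw [Complex.ofReal_mul, Complex.ofReal_ofNat, mul_div_cancel_left₀ _ two_ne_zero,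
      ← Complex.ofReal_cos, hcos]
  have hs : Complex.sin (((2 * Real.arccos ‖W 0 0‖ : ℝ) : ℂ) / 2) = ‖W 1 0‖ := by
    rw [Complex.ofReal_mul, Complex.ofReal_ofNat, mul_div_cancel_left₀ _ two_ne_zero,
      ← Complex.ofReal_sin, hsin]
  have key : ∀ a b c d : ℂ, a + b = d → Complex.exp a * c * Complex.exp b = c * Complex.exp d :=
    fun a b c d h => by rw [← h, Complex.exp_add]; ring
  rw [matRy, hc, hs, matRz, matRz, Matrix.mul_fin_two, Matrix.mul_fin_two]
  ext i j
  fin_cases i <;> fin_cases j <;> simp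
  · refine ha.symm.trans (key _ _ _ _ ?_).symm
    ring
  · rw [h01, ← hb']
    refine congrArg Neg.neg (key _ _ _ _ ?_).symm
    ring
  · refine hb.symm.trans (key _ _ _ _ ?_).symm
    ring
  · rw [h11, ← ha']
    refine (key _ _ _ _ ?_).symm
    ring

/-! ### Assembling the controlled gate -/

theorem rotXY_target {u t : Fin k} (h : u ≠ t) (θ : ℝ) : ∀ g ∈ rotXY h θ, g.target = t := by
  simp [rotXY, Gate.target]

theorem rotXZ_target {u t : Fin k} (h : u ≠ t) (θ : ℝ) : ∀ g ∈ rotXZ h θ, g.target = t := by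
  simp [rotXZ, rotXY, Gate.target]

theorem rotXY_usesOnly {u t : Fin k} (h : u ≠ t) (θ : ℝ) : (rotXY h θ).UsesOnly {u, t} := by
  simp [Circuit.UsesOnly, rotXY, Gate.support]

theorem rotXZ_usesOnly {u t : Fin k} (h : u ≠ t) (θ : ℝ) : (rotXZ h θ).UsesOnly {u, t} := by
  simp [Circuit.UsesOnly, rotXZ, rotXY, Gate.support]

theorem rotXY_costLE {u t : Fin k} (h : u ≠ t) (θ : ℝ) : (rotXY h θ).CostLE 2 4 2 1 :=
  ⟨le_rfl, le_rfl, le_rfl, le_rfl⟩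

theorem rotXZ_costLE {u t : Fin k} (h : u ≠ t) (θ : ℝ) : (rotXZ h θ).CostLE 2 8 6 1 :=
  ⟨le_rfl, le_rfl, le_rfl, le_rfl⟩

theorem Circuit.toOperator_inv_eq {D : Circuit k} {A : Operator k}
    (h : D.toOperator * A = 1) : (Circuit.inv D).toOperator = A := by
  rw [← mul_one (Circuit.inv D).toOperator, ← h, ← mul_assoc, Circuit.inv_mul, one_mul]

/-- The single-qubit identities behind the construction: the rotations cancel unless both the
control of the rotation axes and the control of the two `X` gates are in state `1`. -/
theorem rotation_product (p q r : ℝ) (U F : Prop) [Decidable U] [Decidable F] :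
    (if U then matRz p else matRx p) * (if U then matRy (q / 2) else matRx (-(q / 2))) *
        (if F then matX else 1) * (if U then matRy (-(q / 2)) else matRx (q / 2)) *
        (if U then matRz (-(p + r) / 2) else matRx (-(p + r) / 2)) * (if F then matX else 1) *
        (if U then matRz ((r - p) / 2) else matRx ((r - p) / 2)) =
      if U ∧ F then matRz p * matRy q * matRz r else 1 := by
  by_cases hU : U <;> by_cases hF : F
  · simp only [hU, hF, if_true, and_self]
    have : matRz p * matRy (q / 2) * matX * matRy (-(q / 2)) * matRz (-(p + r) / 2) * matX *
        matRz ((r - p) / 2) = matRz p * matRy (q / 2) * (matX * matRy (-(q / 2))) *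
          (matRz (-(p + r) / 2) * matX) * matRz ((r - p) / 2) := by
      simp only [mul_assoc]
    rw [this, matX_mul_matRy, neg_neg, ← neg_neg (-(p + r) / 2), ← matX_mul_matRz]
    calc _ = matRz p * (matRy (q / 2) * matRy (q / 2)) * (matX * matX) *
          (matRz (-(-(p + r) / 2)) * matRz ((r - p) / 2)) := by simp only [mul_assoc]
      _ = _ := by
        rw [matRy_add, matX_mul_matX, mul_one, matRz_add, add_halves]
        congr 2; ring
  · simp only [hU, hF, if_true, if_false, and_false, mul_one]
    rw [mul_assoc (matRz p), matRy_add, add_neg_cancel, matRy_zero, mul_one, matRz_add,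
      matRz_add, ← matRz_zero]
    congr 1; ring
  -- An X that fires wrongly while `U` fails does no harm: it passes through x rotations and meets
  -- the other X.
  · simp only [hU, hF, if_true, if_false, false_and]
    calc _ = matRx p * matRx (-(q / 2)) * (matX * matRx (q / 2)) *
          (matRx (-(p + r) / 2) * matX) * matRx ((r - p) / 2) := by simp only [mul_assoc]
      _ = matRx p * matRx (-(q / 2)) * matRx (q / 2) * (matX * matX) *
          matRx (-(p + r) / 2) * matRx ((r - p) / 2) := by
        rw [matX_mul_matRx, ← matX_mul_matRx (-(p + r) / 2)]; simp only [mul_assoc]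
      _ = 1 := by
        rw [matX_mul_matX, mul_one, matRx_add, matRx_add, matRx_add, matRx_add, ← matRx_zero]
        congr 1; ring
  · simp only [hU, hF, if_false, and_false, mul_one]
    rw [matRx_add, matRx_add, matRx_add, matRx_add, ← matRx_zero]
    congr 1; ring

/-- Without controls no qubit can steer the axis; the Euler decomposition is used directly, with Ry
obtained from Rx by T² conjugation. -/
theorem implementableWith_empty (t : Fin k) {W : Matrix (Fin 2) (Fin 2) ℂ}
    (hW : W ∈ Matrix.specialUnitaryGroup (Fin 2) ℂ) :
    ImplementableWith {t} ∅ t W 0 4 2 3 := by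
  obtain ⟨p, q, r, rfl⟩ := exists_euler_angles hW
  refine ⟨[.Rz r t, .Tdg t, .Tdg t, .H t, .Rz q t, .H t, .T t, .T t, .Rz p t], ?_, ?_,
    le_rfl, le_rfl, le_rfl, le_rfl⟩
  · simp [Circuit.UsesOnly, Gate.support]
  · rw [Circuit.toOperator_eq (t := t) (by simp [Gate.target]), controlledGate_eq_blockGate]
    congr 1
    funext y
    have e : matRy q = (matT * matT) * (matH * matRz q * matH) * (matTdg * matTdg) := by
      have hI := Complex.I_mul_I
      rw [matH_mul_matRz_mul_matH, matT_mul_matT, matTdg_mul_matTdg, matRx, matRy]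
      ext i j; fin_cases i <;> fin_cases j <;> simp
      · linear_combination -Complex.sin (q / 2) * hI
      · linear_combination Complex.sin (q / 2) * hI
      · linear_combination Complex.cos (q / 2) * hI
    simp only [e, Circuit.mat, Gate.mat, one_mul, mul_assoc, Finset.notMem_empty, false_imp_iff,
      implies_true, if_true]

theorem implementableWith_of_mem {C : Finset (Fin k)} {u t : Fin k} (hu : u ∈ C) (ht : t ∉ C)
    {W : Matrix (Fin 2) (Fin 2) ℂ} (hW : W ∈ Matrix.specialUnitaryGroup (Fin 2) ℂ) :
    ImplementableWith (insert t C) C t W (12 * C.card + 18) (16 * C.card + 40)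
      (8 * C.card + 26) 5 := by
  obtain ⟨p, q, r, hpqr⟩ := exists_euler_angles hW
  obtain ⟨D, F, ph, _, hDc, hDS, hD, hph, hF, hphi, hFC⟩ := exists_conditional_controlled_X hu ht
  have hut : u ≠ t := ne_of_mem_of_not_mem hu ht
  have hXind : ∀ f : (Fin k → Fin 2) → ℂ, IndepOf t f →
      IndepOf t fun y => f y • if F y then matX else 1 := fun f hf y b => by
    simp only [hf y b, hF y b]
  have hphinv : IndepOf t fun y => (ph y)⁻¹ := fun y b => by simp only [hphi y b]
  have hDinv : (Circuit.inv D).toOperator =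
      blockGate t (fun y => (ph y)⁻¹ • if F y then matX else 1) := by
    refine Circuit.toOperator_inv_eq ?_
    rw [hD, blockGate_mul (hXind _ hphi), ← blockGate_one t]
    congr 1
    funext y
    rw [smul_mul_smul_comm, mul_inv_cancel₀ (hph y), one_smul]
    split_ifs
    exacts [matX_mul_matX, mul_one 1]
  have hsub : ({u, t} : Finset (Fin k)) ⊆ insert t C := by
    simp [Finset.insert_subset_iff, hu]
  have hZ : ∀ θ, (rotXZ hut θ).toOperator =
      blockGate t fun y => if y u = 1 then matRz θ else matRx θ := fun θ => by
    rw [Circuit.toOperator_eq (rotXZ_target hut θ)]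
    exact congrArg _ (funext fun y => mat_rotXZ hut θ y)
  have hY : ∀ θ, (rotXY hut θ).toOperator =
      blockGate t fun y => if y u = 1 then matRy (-θ) else matRx θ := fun θ => by
    rw [Circuit.toOperator_eq (rotXY_target hut θ)]
    exact congrArg _ (funext fun y => mat_rotXY hut θ y)
  have hind : ∀ A B : Matrix (Fin 2) (Fin 2) ℂ,
      IndepOf t fun y : Fin k → Fin 2 => if y u = 1 then A else B := fun A B y b => by
    simp only [update_of_ne hut]
  -- The factors of `rotation_product` in reverse, as the head acts first. Using `D` once inverted
  -- cancels `ph`; `rotXY` takes the opposite angle since it yields `matRy (-θ)`.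
  refine ⟨rotXZ hut ((r - p) / 2) ++ (Circuit.inv D ++ (rotXZ hut (-(p + r) / 2) ++
    (rotXY hut (q / 2) ++ (D ++ (rotXY hut (-(q / 2)) ++ rotXZ hut p))))), ?_, ?_, ?_⟩
  · have hz := fun θ => (rotXZ_usesOnly hut θ).mono hsub
    have hy := fun θ => (rotXY_usesOnly hut θ).mono hsub
    exact Circuit.usesOnly_append (hz _) <| Circuit.usesOnly_append (Circuit.usesOnly_inv hDS) <|
      Circuit.usesOnly_append (hz _) <| Circuit.usesOnly_append (hy _) <|
      Circuit.usesOnly_append hDS <| Circuit.usesOnly_append (hy _) (hz _)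
  · simp only [Circuit.toOperator_append, hZ, hY, hD, hDinv]
    simp only [mul_assoc]
    rw [blockGate_mul (hXind _ hphinv), blockGate_mul (hind _ _), blockGate_mul (hind _ _),
      blockGate_mul (hXind _ hphi), blockGate_mul (hind _ _), blockGate_mul (hind _ _),
      controlledGate_eq_blockGate]
    congr 1
    funext y
    have hiff : (y u = 1 ∧ F y) ↔ ∀ j ∈ C, y j = 1 :=
      ⟨fun h => (hFC y h.1).1 h.2, fun h => ⟨h u hu, (hFC y (h u hu)).2 h⟩⟩
    have := rotation_product p q r (y u = 1) (F y)
    rw [if_congr hiff rfl rfl] at this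
    rw [hpqr, ← this]
    simp only [smul_mul_assoc, mul_smul_comm, smul_smul, one_smul,
      mul_assoc, neg_neg, inv_mul_cancel₀ (hph y)]
  · exact ((rotXZ_costLE hut _).append <| hDc.inv.append <| (rotXZ_costLE hut _).append <|
      (rotXY_costLE hut _).append <| hDc.append <| (rotXY_costLE hut _).append
      (rotXZ_costLE hut _)).mono (by omega) (by omega) (by omega) le_rfl

theorem implementableWith_of_notMem {C : Finset (Fin k)} {t : Fin k} (ht : t ∉ C)
    {W : Matrix (Fin 2) (Fin 2) ℂ} (hW : W ∈ Matrix.specialUnitaryGroup (Fin 2) ℂ) :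
    ImplementableWith (insert t C) C t W (12 * C.card + 40) (16 * C.card + 40)
      (8 * C.card + 40) 5 := by
  rcases C.eq_empty_or_nonempty with rfl | ⟨u, hu⟩
  · obtain ⟨D, hS, hD, h₁, h₂, h₃, h₄⟩ := implementableWith_empty t hW
    exact ⟨D, hS, hD, h₁.trans (by omega), h₂.trans (by omega), h₃.trans (by omega),
      h₄.trans (by norm_num)⟩
  · obtain ⟨D, hS, hD, h₁, h₂, h₃, h₄⟩ := implementableWith_of_mem hu ht hW
    exact ⟨D, hS, hD, h₁.trans (by omega), h₂.trans (by omega), h₃.trans (by omega), h₄⟩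

end MCSU2

end

theorem mainTheorem7 :
    ∃ c : ℕ,
      (∀ (k : ℕ) (C : Finset (Fin k)) (t : Fin k), t ∉ C →
        ∀ W ∈ Matrix.specialUnitaryGroup (Fin 2) ℂ,
          MCSU2.ImplementableWith (insert t C) C t W
            (12 * C.card + c) (16 * C.card + c) (8 * C.card + c) 6) ∧
      (∀ (k : ℕ) (C : Finset (Fin k)) (t a : Fin k), t ∉ C → a ∉ insert t C →
        ∀ W ∈ Matrix.specialUnitaryGroup (Fin 2) ℂ,
          MCSU2.ImplementableWith (insert a (insert t C)) C t W
            (12 * C.card + c) (16 * C.card + c) (8 * C.card + c) 5) := by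
  -- The bound 40 is the T overhead: 4 for each of two X gates, 8 for each of three `rotXZ`, 4 for
  -- each of two `rotXY`.
  refine ⟨40, fun k C t ht W hW => ?_, fun k C t a ht _ W hW => ?_⟩
  · obtain ⟨D, hS, hD, h₁, h₂, h₃, h₄⟩ := MCSU2.implementableWith_of_notMem ht hW
    exact ⟨D, hS, hD, h₁, h₂, h₃, h₄.trans (by norm_num)⟩
  · obtain ⟨D, hS, hD⟩ := MCSU2.implementableWith_of_notMem ht hW
    exact ⟨D, hS.mono (Finset.subset_insert _ _), hD⟩
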